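/- Let $n\ge 1$, $m\ge 2$ and $d>0$. Objects with distinct ranks arrive at times $1,\dots,n$, all $n!$ orders being equally likely; an object is a \emph{candidate} if it is the best among those that have arrived so far. In the $m$-choice duration problem with replacement cost $d$ at most $m$ candidates are selected one after the other, at stopping times $\tau_1<\tau_2<\dots$ for the sequence of relative ranks (put $\tau_k=n+1$ if no $k$-th selection is made). A candidate selected at time $i$ yields its duration $\mathcal D_n(i)=\mathcal T_n(i)-i$, where $\mathcal T_n(i)$ is the time of the first candidate after time $i$ ($n+1$ if there is none), and each selection other than the first costs $d$. A strategy is optimal if it maximizes the expected net payoff $\mathbf E\big[\sum_{k=1}^m\mathcal D_n(\tau_k)-d\,\#\{2\le k\le m:\tau_k\le n\}\big]$ (with $\mathcal D_n(n+1)=0$). Let $U_i$ be the mean of $\mathcal D_n(i)$ given that the $i$-th object is a candidate, $H_j=\sum_{\ell=1}^j 1/\ell$, and $K(n)=\min\{i\ge 1:H_n-H_i\le 1\}$. For $c\ge 0$ let $a(n,c)$ and $b(n,c)$ be the least and the greatest $i\in\{1,\dots,n\}$ with $U_i\ge c$ and, with $b=b(n,c)$ and $1\le i\le b$, $$G_i^{(1)}(c)=H_n-H_{i-1}-\sum_{j=i+1}^{b}\frac{H_n-H_{j-1}}{j-1}-\frac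 cb .$$ Suppose that $d<U_{K(n)}$ and put $b=b(n,d)$. Then there are integers $s_1(d),\dots,s_m(d)$ and $t_m(d)$ with the following properties. (i) With $G_i^{(k)}(d)=G_i^{(1)}(d)+\sum_{j=\max(i+1,s_{k-1}(d))}^{b}\frac{1}{j-1}G_j^{(k-1)}(d)$ for $2\le k\le m$, one has $s_k(d)=\min\{1\le i\le b:G_i^{(k)}(d)\ge 0\}$ for $1\le k\le m$. Moreover $s_k(d)$ is nonincreasing in $k$ and $s_m(d)\ge a(n,d)$. (ii) The difference $g(d)=G_i^{(1)}(0)-G_i^{(1)}(d)$ does not depend on $i\in\{1,\dots,b\}$, one has $t_m(d)=\min\{1\le i\le b:G_i^{(m)}(d)+g(d)\ge 0\}$, and $t_m(d)\le s_m(d)$. (iii) The following strategy is optimal: first select the first candidate (if any) at or after time $t_m(d)$; thereafter, whenever $k$ more replacements are available ($1\le k\le m-1$), replace the held object by the first new candidate (if any) that appears at or after time $s_k(d)$ but no later than $b(n,d)$. Moreover, this replacement rule remains optimal after any number $l\ge 1$ of selections, however these were made: keeping the first $l$ selections of any strategy and following the rule afterwards gives again a strategy, whose expected net payoff is at least as large.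 -/

import Mathlib

namespace ReplacementDuration

/-- The relative rank `X_i` of the `i`-th object among the first `i` objects (`1 ≤ i ≤ n`).
`ω` is the order of arrival: the object that arrives at time `j + 1` has absolute rank `ω j`,
and `0` is the best rank. Times outside `{1, …, n}` get the value `0`. -/
def relRank (n : ℕ) (ω : Equiv.Perm (Fin n)) (i : ℕ) : ℕ :=
  if h : 1 ≤ i ∧ i ≤ n then
    (Finset.univ.filter fun j : Fin n =>
      (j : ℕ) + 1 ≤ i ∧ ω j ≤ ω ⟨i - 1, by omega⟩).card
  else 0

/-- The `i`-th object is a candidate: it is the best among the first `i` objects. -/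
def IsCandidate (n : ℕ) (ω : Equiv.Perm (Fin n)) (i : ℕ) : Prop :=
  relRank n ω i = 1

instance (n : ℕ) (ω : Equiv.Perm (Fin n)) (i : ℕ) : Decidable (IsCandidate n ω i) :=
  inferInstanceAs (Decidable (relRank n ω i = 1))

/-- The arrival time of the first candidate in the time interval `[lo, hi]`,
and `n + 1` if there is none. -/
noncomputable def firstCandidate (n : ℕ) (ω : Equiv.Perm (Fin n)) (lo hi : ℕ) : ℕ :=
  sInf ({j : ℕ | lo ≤ j ∧ j ≤ hi ∧ IsCandidate n ω j} ∪ {n + 1})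

/-- The duration `𝒟_n(i) = 𝒯_n(i) - i`, where `𝒯_n(i)` is the arrival time of the first candidate
after time `i` (and `n + 1` if there is none). It is `0` for `i = n + 1`. -/
noncomputable def duration (n : ℕ) (ω : Equiv.Perm (Fin n)) (i : ℕ) : ℝ :=
  (firstCandidate n ω (i + 1) n : ℝ) - (i : ℝ)

/-- Expectation over the `n!` equally likely orders of arrival. -/
noncomputable def expectation (n : ℕ) (f : Equiv.Perm (Fin n) → ℝ) : ℝ :=
  (∑ ω : Equiv.Perm (Fin n), f ω) / (Nat.factorial n : ℝ)

/-- `τ` is a stopping time for the sequence of relative ranks: whether `τ = i` is determined by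
`X_1, …, X_i`. -/
def IsStopping (n : ℕ) (τ : Equiv.Perm (Fin n) → ℕ) : Prop :=
  ∀ (i : ℕ) (ω ω' : Equiv.Perm (Fin n)),
    (∀ j ≤ i, relRank n ω j = relRank n ω' j) → τ ω = i → τ ω' = i

/-- The set `C_m` of stopping vectors `(τ_1, …, τ_m)` (only the indices `1, …, m` matter).
`τ_k` is the time of the `k`-th selection, `τ_k = n + 1` meaning that no `k`-th selection is made.
Only candidates are selected, and the selections take place one after the other. -/
def StoppingVector (n m : ℕ) (τ : ℕ → Equiv.Perm (Fin n) → ℕ) : Prop :=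
  (∀ k, 1 ≤ k → k ≤ m →
    IsStopping n (τ k) ∧ ∀ ω, IsCandidate n ω (τ k ω) ∨ τ k ω = n + 1) ∧
  (∀ k, 1 ≤ k → k < m →
    ∀ ω, τ k ω < τ (k + 1) ω ∨ (τ k ω = n + 1 ∧ τ (k + 1) ω = n + 1))

/-- The net payoff: the total time of possession of a relatively best object, less the cost `d` for
every selection other than the first. -/
noncomputable def netPayoff (n m : ℕ) (d : ℝ) (τ : ℕ → Equiv.Perm (Fin n) → ℕ)
    (ω : Equiv.Perm (Fin n)) : ℝ :=
  (∑ k ∈ Finset.Icc 1 m, duration n ω (τ k ω))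
    - d * (((Finset.Icc 2 m).filter fun k => τ k ω ≤ n).card : ℝ)

/-- `U_i`, the mean period for which the `i`-th object remains a candidate, given that it is a
candidate. -/
noncomputable def meanDuration (n i : ℕ) : ℝ :=
  (∑ ω : Equiv.Perm (Fin n) with IsCandidate n ω i, duration n ω i) /
    ((Finset.univ.filter fun ω : Equiv.Perm (Fin n) => IsCandidate n ω i).card : ℝ)

/-- `K(n) = min {i ≥ 1 : H_n - H_i ≤ 1}`, with `H_j` the harmonic numbers. -/
noncomputable def criticalK (n : ℕ) : ℕ :=
  sInf {i : ℕ | 1 ≤ i ∧ (harmonic n : ℝ) - (harmonic i : ℝ) ≤ 1}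

/-- `a(n, c)`, the least `i` in `{1, …, n}` with `U_i ≥ c`. -/
noncomputable def lowerIndex (n : ℕ) (c : ℝ) : ℕ :=
  sInf {i : ℕ | 1 ≤ i ∧ i ≤ n ∧ c ≤ meanDuration n i}

/-- `b(n, c)`, the greatest `i` in `{1, …, n}` with `U_i ≥ c`. -/
noncomputable def upperIndex (n : ℕ) (c : ℝ) : ℕ :=
  sSup {i : ℕ | 1 ≤ i ∧ i ≤ n ∧ c ≤ meanDuration n i}

/-- `G_i^{(1)}(c) = H_n - H_{i-1} - ∑_{j=i+1}^{b} (H_n - H_{j-1}) / (j - 1) - c / b`,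
with `b = b(n, c)`, for `1 ≤ i ≤ b`. -/
noncomputable def gainOne (n : ℕ) (c : ℝ) (i : ℕ) : ℝ :=
  (harmonic n : ℝ) - (harmonic (i - 1) : ℝ)
    - (∑ j ∈ Finset.Icc (i + 1) (upperIndex n c),
        1 / ((j : ℝ) - 1) * ((harmonic n : ℝ) - (harmonic (j - 1) : ℝ)))
    - c / (upperIndex n c : ℝ)

/-- `gain n c s k i` is `G_i^{(k)}(c)`, `k ≥ 1`, defined from `G^{(1)}(c)` and critical numbers
`s_1, s_2, …` by
`G_i^{(k+1)} = G_i^{(1)} + ∑_{j = max (i+1, s_k)}^{b} G_j^{(k)} / (j - 1)`.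
(The value at the unused index `k = 0` is immaterial.) -/
noncomputable def gain (n : ℕ) (c : ℝ) (s : ℕ → ℕ) : ℕ → ℕ → ℝ
  | 0, _ => 0
  | 1, i => gainOne n c i
  | k + 2, i => gainOne n c i +
      ∑ j ∈ Finset.Icc (max (i + 1) (s (k + 1))) (upperIndex n c),
        1 / ((j : ℝ) - 1) * gain n c s (k + 1) j

/-- The stopping vector that makes the first `l` selections as `τ` does and makes all later ones by
the threshold rule: the first selection is the first candidate at or after time `t`; when `k ≥ 1`
selections have been made, so that `m - k` replacements are available, the next selection is the
first new candidate at or after time `s (m - k)` but no later than `b`. For `l = 0` the vector `τ`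
plays no role. -/
noncomputable def thresholdAfter (n m t b : ℕ) (s : ℕ → ℕ) (l : ℕ)
    (τ : ℕ → Equiv.Perm (Fin n) → ℕ) : ℕ → Equiv.Perm (Fin n) → ℕ
  | 0, _ => 0
  | k + 1, ω =>
    if k + 1 ≤ l then τ (k + 1) ω
    else if k = 0 then firstCandidate n ω t n
    else firstCandidate n ω
      (max (thresholdAfter n m t b s l τ k ω + 1) (s (m - k))) b

/-- The threshold rule from the start. -/
noncomputable def thresholdRule (n m t b : ℕ) (s : ℕ → ℕ) : ℕ → Equiv.Perm (Fin n) → ℕ :=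
  thresholdAfter n m t b s 0 (fun _ _ => 0)

end ReplacementDuration

namespace ReplacementDuration

open Finset

/-! The relative ranks are independent and uniform (`rankCode_bijective`), so the `i`-th object is a
candidate with probability `1 / i` independently of the past (`expectation_candidate`). Hence a
candidate selected at time `i` is worth `U_i = i (H_n - H_{i-1})` whatever happened before, and the
mean payoff depends only on the laws of the selection times (`expectation_netPayoff`).

Let `V_k(i)` be the sum of `G_j^{(k)}` over `j > i` in `[s_k, b]`. It is the value of `k`
replacements right after time `i`, for two reasons. By independence, a tail sum of `F_j` is the mean
of collecting `j F_j` at every candidate (`expectation_tail`). And `i G_i^{(k+1)} = U_i - d + V_k(i)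
- ∑_{i<j≤b} G_j^{(k+1)}` (`mul_gain_eq`), so replacing at a candidate has advantage `i G_i^{(k+1)} ≥
0` over waiting on `[s_{k+1}, b]` and none elsewhere (`replacement_advantage`). Thus rewards so far
plus `V` never increase in mean under a further selection and stay constant under the threshold
rule; telescoping gives optimality after any `l ≥ 1` selections.

That each `G^{(k)}` changes sign only once on `[1, b]`, with `s_k` nonincreasing, is an induction on
`k` (`critical_spec`). The first selection is free and may be made up to time `n`: the same argument
runs with `G^{(1)}(0)` in place of `G^{(1)}(d)` (`firstGain`). On `[1, b]` this adds a constant `g ≥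
0` (`gainShift_nonneg`), whence `t_m ≤ s_m`. -/

variable {n : ℕ}

/-! ### Relative ranks and their independence -/

lemma relRank_succ (ω : Equiv.Perm (Fin n)) (k : Fin n) :
    relRank n ω (k + 1) = #{j : Fin n | j ≤ k ∧ ω j ≤ ω k} := by
  have h : 1 ≤ (k : ℕ) + 1 ∧ (k : ℕ) + 1 ≤ n := ⟨by omega, k.2⟩
  rw [relRank, dif_pos h]
  refine congrArg card (filter_congr fun j _ => ?_)
  exact and_congr Nat.succ_le_succ_iff Iff.rfl

lemma relRank_succ_pos (ω : Equiv.Perm (Fin n)) (k : Fin n) : 0 < relRank n ω (k + 1) := by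
  rw [relRank_succ]
  exact card_pos.2 ⟨k, by simp⟩

lemma relRank_succ_le (ω : Equiv.Perm (Fin n)) (k : Fin n) : relRank n ω (k + 1) ≤ k + 1 := by
  rw [relRank_succ, ← Fin.card_Iic]
  exact card_le_card fun j hj => by simp at hj ⊢; exact hj.1

lemma relRank_eq_zero {ω : Equiv.Perm (Fin n)} {i : ℕ} (h : ¬(1 ≤ i ∧ i ≤ n)) :
    relRank n ω i = 0 := by
  rw [relRank, dif_neg h]

lemma IsCandidate.bounds {ω : Equiv.Perm (Fin n)} {i : ℕ} (h : IsCandidate n ω i) :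
    1 ≤ i ∧ i ≤ n := by
  by_contra hc
  rw [IsCandidate, relRank_eq_zero hc] at h
  exact absurd h (by norm_num)

/-- The relative ranks determine the order pattern of the first objects. -/
lemma le_iff_le_of_relRank_eq {ω ω' : Equiv.Perm (Fin n)}
    (h : ∀ k : Fin n, relRank n ω (k + 1) = relRank n ω' (k + 1)) (m : ℕ) :
    ∀ a b : Fin n, (a : ℕ) < m → (b : ℕ) < m → (ω a ≤ ω b ↔ ω' a ≤ ω' b) := by
  induction m with
  | zero => intro a b ha; omega
  | succ m ih =>
    have key : ∀ a k : Fin n, (k : ℕ) = m → (a : ℕ) < m → (ω a ≤ ω k ↔ ω' a ≤ ω' k) := by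
      intro a k hk ha
      have hc := h k
      rw [relRank_succ, relRank_succ] at hc
      set S : Finset (Fin n) := {j | j ≤ k ∧ ω j ≤ ω k} with hS
      set S' : Finset (Fin n) := {j | j ≤ k ∧ ω' j ≤ ω' k} with hS'
      -- Apart from `k`, both sets are initial segments of the same ordering of the earlier objects,
      -- hence nested; equal relative ranks give equal cardinalities.
      have hnest : S ⊆ S' ∨ S' ⊆ S := by
        by_contra! hcon
        obtain ⟨x, hx, hx'⟩ := not_subset.1 hcon.1
        obtain ⟨y, hy, hy'⟩ := not_subset.1 hcon.2
        simp only [hS, hS', mem_filter, mem_univ, true_and, not_and, not_le] at hx hx' hy hy'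
        have h1 := hx' hx.1
        have h2 := hy' hy.1
        have hxk : (x : ℕ) < m := by
          rcases hx.1.lt_or_eq with hlt | rfl
          · rw [Fin.lt_def] at hlt; omega
          · exact absurd h1 (lt_irrefl _)
        have hyk : (y : ℕ) < m := by
          rcases hy.1.lt_or_eq with hlt | rfl
          · rw [Fin.lt_def] at hlt; omega
          · exact absurd h2 (lt_irrefl _)
        have h3 := (ih x y hxk hyk).1 (hx.2.trans h2.le)
        exact absurd (h3.trans hy.2) (not_le.2 h1)
      have hSS : S = S' := by
        rcases hnest with h1 | h1
        · exact eq_of_subset_of_card_le h1 hc.ge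
        · exact (eq_of_subset_of_card_le h1 hc.le).symm
      have hak : a ≤ k := by rw [Fin.le_def]; omega
      have := congrArg (a ∈ ·) hSS
      simpa [hS, hS', hak] using this
    intro a b ha hb
    rcases Nat.lt_succ_iff_lt_or_eq.1 ha with ha' | ha' <;>
      rcases Nat.lt_succ_iff_lt_or_eq.1 hb with hb' | hb'
    · exact ih a b ha' hb'
    · exact key a b hb' ha'
    · have hne : b ≠ a := by rintro rfl; omega
      have h1 : ω b ≠ ω a := fun e => hne (ω.injective e)
      have h2 : ω' b ≠ ω' a := fun e => hne (ω'.injective e)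
      have h3 := key b a ha' hb'
      rw [← not_lt, ← not_lt, not_iff_not, lt_iff_le_and_ne, lt_iff_le_and_ne]
      tauto
    · obtain rfl : a = b := Fin.ext (by omega)
      simp

lemma eq_of_relRank_eq {ω ω' : Equiv.Perm (Fin n)}
    (h : ∀ k : Fin n, relRank n ω (k + 1) = relRank n ω' (k + 1)) : ω = ω' := by
  let e : Fin n ≃o Fin n :=
    { toEquiv := ω.symm.trans ω'
      map_rel_iff' := by
        intro a b
        have := le_iff_le_of_relRank_eq h n (ω.symm a) (ω.symm b) (Fin.is_lt _) (Fin.is_lt _)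
        simpa using this.symm }
  -- `ω' ∘ ω⁻¹` is an order automorphism of `Fin n`, and only the identity is one.
  have he : e = OrderIso.refl _ := Subsingleton.elim _ _
  ext a
  have := congrArg (fun f : Fin n ≃o Fin n => f (ω a)) he
  simp [e] at this
  rw [this]

/-- The sequence of relative ranks, shifted to start at `0`. -/
def rankCode (ω : Equiv.Perm (Fin n)) (k : Fin n) : Fin (k + 1) :=
  ⟨relRank n ω (k + 1) - 1, by
    have := relRank_succ_pos ω k
    have := relRank_succ_le ω k
    omega⟩

/-- Injectivity and the count `∏ (k + 1) = n!` suffice. Consequently the uniform law on orders is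
the product of uniform laws on the rank codes. -/
lemma rankCode_bijective : Function.Bijective (rankCode (n := n)) := by
  rw [Fintype.bijective_iff_injective_and_card]
  constructor
  · intro ω ω' h
    refine eq_of_relRank_eq fun k => ?_
    have := congrArg Fin.val (congrFun h k)
    simp only [rankCode] at this
    have := relRank_succ_pos ω k
    have := relRank_succ_pos ω' k
    omega
  · rw [Fintype.card_perm, Fintype.card_fin, Fintype.card_pi]
    simp only [Fintype.card_fin]
    rw [Fin.prod_univ_eq_prod_range (fun i => i + 1) n, prod_range_add_one_eq_factorial]

lemma isCandidate_succ_iff (ω : Equiv.Perm (Fin n)) (k : Fin n) :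
    IsCandidate n ω (k + 1) ↔ rankCode ω k = 0 := by
  have := relRank_succ_pos ω k
  rw [IsCandidate, Fin.ext_iff]
  simp only [rankCode, Fin.val_zero]
  omega

lemma relRank_eq_iff (ω ω' : Equiv.Perm (Fin n)) (k : Fin n) :
    relRank n ω (k + 1) = relRank n ω' (k + 1) ↔ rankCode ω k = rankCode ω' k := by
  have := relRank_succ_pos ω k
  have := relRank_succ_pos ω' k
  rw [Fin.ext_iff]
  simp only [rankCode]
  omega

/-- `f` is a function of the relative ranks `X_1, …, X_i`. -/
def DeterminedBy {α : Type*} (i : ℕ) (f : Equiv.Perm (Fin n) → α) : Prop :=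
  ∀ ω ω', (∀ j ≤ i, relRank n ω j = relRank n ω' j) → f ω = f ω'

/-- Split off the `k`-th coordinate of the code: `f` ignores it, and exactly one of its `k + 1`
values makes the object a candidate. -/
lemma sum_candidate_mul (k : Fin n) {f : Equiv.Perm (Fin n) → ℝ} (hf : DeterminedBy (k : ℕ) f) :
    ((k : ℝ) + 1) * ∑ ω, (if IsCandidate n ω (k + 1) then f ω else 0) = ∑ ω, f ω := by
  classical
  let e := Equiv.ofBijective (rankCode (n := n)) rankCode_bijective
  let p := e.trans (Equiv.piSplitAt k fun k : Fin n => Fin (k + 1))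
  have hp : ∀ z, rankCode (p.symm z) k = z.1 := by
    intro z
    have h : (p (p.symm z)).1 = z.1 := by rw [Equiv.apply_symm_apply]
    exact h
  have hp' : ∀ z (j : Fin n) (hj : j ≠ k), rankCode (p.symm z) j = z.2 ⟨j, hj⟩ := by
    intro z j hj
    have h : (p (p.symm z)).2 ⟨j, hj⟩ = z.2 ⟨j, hj⟩ := by rw [Equiv.apply_symm_apply]
    exact h
  have hc : ∀ r y, f (p.symm (r, y)) = f (p.symm (0, y)) := by
    intro r y
    refine hf _ _ fun j hj => ?_
    by_cases hj1 : 1 ≤ j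
    · have hjn : j - 1 < n := by have := k.2; omega
      have := relRank_eq_iff (p.symm (r, y)) (p.symm (0, y)) ⟨j - 1, hjn⟩
      simp only [Nat.sub_add_cancel hj1] at this
      rw [this]
      have hne : (⟨j - 1, hjn⟩ : Fin n) ≠ k := by rw [Ne, Fin.ext_iff]; simp only; omega
      rw [hp' _ _ hne, hp' _ _ hne]
    · rw [relRank_eq_zero (by omega), relRank_eq_zero (by omega)]
  rw [← Equiv.sum_comp p.symm, ← Equiv.sum_comp p.symm f, Fintype.sum_prod_type_right,
    Fintype.sum_prod_type_right, mul_sum]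
  refine sum_congr rfl fun y _ => ?_
  simp only [isCandidate_succ_iff, hp, hc]
  simp

/-- The event that the `i`-th object is a candidate has probability `1 / i`
and is independent of the earlier relative ranks. -/
lemma expectation_candidate {i : ℕ} (h1 : 1 ≤ i) (hi : i ≤ n) {f : Equiv.Perm (Fin n) → ℝ}
    (hf : DeterminedBy (i - 1) f) :
    expectation n f = i * expectation n (fun ω => if IsCandidate n ω i then f ω else 0) := by
  have h := sum_candidate_mul (⟨i - 1, by omega⟩ : Fin n) hf
  simp only [Nat.sub_add_cancel h1] at h
  have hcast : ((i - 1 : ℕ) : ℝ) + 1 = i := by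
    rw [Nat.cast_sub h1]; simp
  rw [hcast] at h
  rw [expectation, expectation, ← h, mul_div_assoc]

lemma expectation_add (f g : Equiv.Perm (Fin n) → ℝ) :
    expectation n (fun ω => f ω + g ω) = expectation n f + expectation n g := by
  simp only [expectation, sum_add_distrib, add_div]

lemma expectation_sub (f g : Equiv.Perm (Fin n) → ℝ) :
    expectation n (fun ω => f ω - g ω) = expectation n f - expectation n g := by
  simp only [expectation, sum_sub_distrib, sub_div]

lemma expectation_mul_left (c : ℝ) (f : Equiv.Perm (Fin n) → ℝ) :
    expectation n (fun ω => c * f ω) = c * expectation n f := by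
  simp only [expectation, ← mul_sum, mul_div_assoc]

lemma expectation_sum {ι : Type*} (s : Finset ι) (f : ι → Equiv.Perm (Fin n) → ℝ) :
    expectation n (fun ω => ∑ k ∈ s, f k ω) = ∑ k ∈ s, expectation n (f k) := by
  simp only [expectation, sum_comm (s := univ), sum_div]

lemma expectation_mono {f g : Equiv.Perm (Fin n) → ℝ} (h : ∀ ω, f ω ≤ g ω) :
    expectation n f ≤ expectation n g := by
  unfold expectation
  have := sum_le_sum fun ω (_ : ω ∈ univ) => h ω
  gcongr

lemma expectation_const (c : ℝ) : expectation n (fun _ => c) = c := by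
  have : (n.factorial : ℝ) ≠ 0 := by positivity
  simp [expectation, Fintype.card_perm]
  field_simp

/-! ### Arrival times of candidates -/

lemma firstCandidate_eq_of_candidate {ω : Equiv.Perm (Fin n)} {lo hi : ℕ} (h : lo ≤ hi)
    (hc : IsCandidate n ω lo) : firstCandidate n ω lo hi = lo := by
  refine IsLeast.csInf_eq ⟨Or.inl ⟨le_rfl, h, hc⟩, ?_⟩
  rintro j (hj | hj)
  · exact hj.1
  · have := hc.bounds.2
    rw [Set.mem_singleton_iff] at hj; omega

lemma firstCandidate_eq_of_not_candidate {ω : Equiv.Perm (Fin n)} {lo hi : ℕ}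
    (hc : ¬IsCandidate n ω lo) : firstCandidate n ω lo hi = firstCandidate n ω (lo + 1) hi := by
  unfold firstCandidate
  congr 2
  ext j
  refine ⟨fun h => ⟨?_, h.2⟩, fun h => ⟨by have := h.1; omega, h.2⟩⟩
  rcases h.1.lt_or_eq with h' | rfl
  · exact h'
  · exact absurd h.2.2 hc

lemma firstCandidate_eq_of_lt {ω : Equiv.Perm (Fin n)} {lo hi : ℕ} (h : hi < lo) :
    firstCandidate n ω lo hi = n + 1 := by
  refine IsLeast.csInf_eq ⟨Or.inr rfl, ?_⟩
  rintro j (hj | hj)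
  · have := hj.1; have := hj.2.1; omega
  · exact (Set.mem_singleton_iff.1 hj).ge

lemma firstCandidate_mem (ω : Equiv.Perm (Fin n)) (lo hi : ℕ) :
    (lo ≤ firstCandidate n ω lo hi ∧ firstCandidate n ω lo hi ≤ hi ∧
      IsCandidate n ω (firstCandidate n ω lo hi)) ∨ firstCandidate n ω lo hi = n + 1 :=
  Nat.sInf_mem (s := {j : ℕ | lo ≤ j ∧ j ≤ hi ∧ IsCandidate n ω j} ∪ {n + 1}) ⟨n + 1, Or.inr rfl⟩

lemma firstCandidate_le {ω : Equiv.Perm (Fin n)} {lo hi j : ℕ} (h1 : lo ≤ j) (h2 : j ≤ hi)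
    (hc : IsCandidate n ω j) : firstCandidate n ω lo hi ≤ j :=
  Nat.sInf_le (Or.inl ⟨h1, h2, hc⟩)

lemma duration_top (ω : Equiv.Perm (Fin n)) : duration n ω n = 1 := by
  rw [duration, firstCandidate_eq_of_lt (by omega)]
  push_cast; ring

lemma duration_succ_top (ω : Equiv.Perm (Fin n)) : duration n ω (n + 1) = 0 := by
  rw [duration, firstCandidate_eq_of_lt (by omega)]
  push_cast; ring

lemma duration_of_lt (ω : Equiv.Perm (Fin n)) {i : ℕ} (hi : i < n) :
    duration n ω i = 1 + if IsCandidate n ω (i + 1) then 0 else duration n ω (i + 1) := by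
  split_ifs with h
  · rw [duration, firstCandidate_eq_of_candidate (by omega) h]
    push_cast; ring
  · rw [duration, duration, firstCandidate_eq_of_not_candidate h]
    push_cast; ring

lemma harmonic_sub_one {i : ℕ} (h : 1 ≤ i) :
    (harmonic (i - 1) : ℝ) = harmonic i - 1 / i := by
  obtain ⟨k, rfl⟩ := Nat.exists_eq_add_of_le' h
  rw [harmonic_succ]
  push_cast
  simp

lemma DeterminedBy.not_candidate {i : ℕ} {f : Equiv.Perm (Fin n) → ℝ} (hf : DeterminedBy i f) :
    DeterminedBy (i + 1) fun ω => if IsCandidate n ω (i + 1) then 0 else f ω := by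
  intro ω ω' h
  have h1 : IsCandidate n ω (i + 1) ↔ IsCandidate n ω' (i + 1) := by
    rw [IsCandidate, IsCandidate, h _ le_rfl]
  simp only [h1, hf ω ω' fun j hj => h j (by omega)]

/-- The conditional mean of the duration, given the first `i` relative ranks. -/
lemma expectation_mul_duration {i : ℕ} (h1 : 1 ≤ i) (hi : i ≤ n) {f : Equiv.Perm (Fin n) → ℝ}
    (hf : DeterminedBy i f) :
    expectation n (fun ω => f ω * duration n ω i) =
      i * ((harmonic n : ℝ) - harmonic (i - 1)) * expectation n f := by
  obtain ⟨e, he⟩ : ∃ e, n - i = e := ⟨_, rfl⟩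
  induction e generalizing i f with
  | zero =>
    obtain rfl : i = n := by omega
    have : (i : ℝ) ≠ 0 := by positivity
    simp only [duration_top, mul_one, harmonic_sub_one h1]
    field_simp
    ring
  | succ e ih =>
    have hlt : i < n := by omega
    have hi0 : (i : ℝ) ≠ 0 := by positivity
    -- The duration is one unit plus, unless a candidate arrives at `i + 1`, the duration from `i +
    -- 1`; the truncated `f` is determined by `i + 1` ranks, so the induction applies to it.
    have e1 : ∀ ω, f ω * duration n ω i =
        f ω + (if IsCandidate n ω (i + 1) then 0 else f ω) * duration n ω (i + 1) := by
      intro ω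
      rw [duration_of_lt ω hlt]
      split_ifs <;> ring
    have e2 : ∀ ω, (if IsCandidate n ω (i + 1) then 0 else f ω) =
        f ω - if IsCandidate n ω (i + 1) then f ω else 0 := by
      intro ω
      split_ifs <;> ring
    have e3 := expectation_candidate (i := i + 1) (by omega) hlt (f := f) (by simpa using hf)
    simp only [e1]
    rw [expectation_add, ih (by omega) hlt hf.not_candidate (by omega)]
    simp only [e2]
    rw [expectation_sub, e3, harmonic_sub_one h1, Nat.succ_eq_add_one, Nat.add_sub_cancel]
    push_cast
    field_simp
    ring

/-! ### Mean durations and gains -/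

lemma meanDuration_eq {i : ℕ} (h1 : 1 ≤ i) (hi : i ≤ n) :
    meanDuration n i = i * ((harmonic n : ℝ) - harmonic (i - 1)) := by
  have hdet : DeterminedBy i fun ω : Equiv.Perm (Fin n) =>
      if IsCandidate n ω i then (1 : ℝ) else 0 := by
    intro ω ω' h
    have h1 : IsCandidate n ω i ↔ IsCandidate n ω' i := by
      rw [IsCandidate, IsCandidate, h _ le_rfl]
    simp only [h1]
  have e1 := expectation_mul_duration h1 hi hdet
  have e2 := expectation_candidate h1 hi (f := fun _ => (1 : ℝ)) fun _ _ _ => rfl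
  rw [expectation_const] at e2
  have e3 : expectation n (fun ω => if IsCandidate n ω i then (1 : ℝ) else 0) ≠ 0 := by
    intro h
    rw [h] at e2
    simp at e2
  have hfac : (n.factorial : ℝ) ≠ 0 := by positivity
  rw [meanDuration, sum_filter, card_filter]
  push_cast
  simp only [ite_mul, one_mul, zero_mul] at e1
  unfold expectation at e1 e3
  have e4 := (div_ne_zero_iff.1 e3).1
  rw [← mul_div_assoc, div_left_inj' hfac] at e1
  rw [div_eq_iff e4, e1]

lemma meanDuration_top (hn : 1 ≤ n) : meanDuration n n = 1 := by
  have : (n : ℝ) ≠ 0 := by positivity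
  rw [meanDuration_eq hn le_rfl, harmonic_sub_one hn]
  field_simp
  ring

lemma meanDuration_sub_succ {i : ℕ} (h1 : 1 ≤ i) (hi : i + 1 ≤ n) :
    meanDuration n i - meanDuration n (i + 1) = 1 - ((harmonic n : ℝ) - harmonic i) := by
  have : (i : ℝ) ≠ 0 := by positivity
  rw [meanDuration_eq h1 (by omega), meanDuration_eq (by omega) hi, harmonic_sub_one h1,
    Nat.add_sub_cancel]
  push_cast
  field_simp
  ring

lemma harmonic_mono {i j : ℕ} (h : i ≤ j) : (harmonic i : ℝ) ≤ harmonic j := by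
  induction h with
  | refl => exact le_rfl
  | @step k _ ih =>
    rw [harmonic_succ]
    push_cast
    have : (0 : ℝ) ≤ ((k : ℝ) + 1)⁻¹ := by positivity
    linarith

lemma criticalK_mem (hn : 1 ≤ n) :
    1 ≤ criticalK n ∧ (harmonic n : ℝ) - harmonic (criticalK n) ≤ 1 :=
  Nat.sInf_mem (s := {i : ℕ | 1 ≤ i ∧ (harmonic n : ℝ) - (harmonic i : ℝ) ≤ 1})
    ⟨n, hn, by simp⟩

lemma criticalK_le (hn : 1 ≤ n) : criticalK n ≤ n :=
  Nat.sInf_le ⟨hn, by simp⟩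

lemma one_lt_of_lt_criticalK {i : ℕ} (h1 : 1 ≤ i) (hi : i < criticalK n) :
    1 < (harmonic n : ℝ) - harmonic i := by
  by_contra h
  exact Nat.notMem_of_lt_sInf hi ⟨h1, not_lt.1 h⟩

lemma le_one_of_criticalK_le {i : ℕ} (hn : 1 ≤ n) (hi : criticalK n ≤ i) :
    (harmonic n : ℝ) - harmonic i ≤ 1 := by
  have := (criticalK_mem hn).2
  have := harmonic_mono hi
  linarith

lemma bddAbove_indices (c : ℝ) :
    BddAbove {i : ℕ | 1 ≤ i ∧ i ≤ n ∧ c ≤ meanDuration n i} :=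
  ⟨n, fun _ h => h.2.1⟩

lemma le_upperIndex {c : ℝ} {i : ℕ} (h1 : 1 ≤ i) (hi : i ≤ n) (hc : c ≤ meanDuration n i) :
    i ≤ upperIndex n c :=
  le_csSup (bddAbove_indices c) ⟨h1, hi, hc⟩

lemma criticalK_le_upperIndex {c : ℝ} (hn : 1 ≤ n) (hc : c ≤ meanDuration n (criticalK n)) :
    criticalK n ≤ upperIndex n c :=
  le_upperIndex (criticalK_mem hn).1 (criticalK_le hn) hc

lemma upperIndex_mem {c : ℝ} (hn : 1 ≤ n) (hc : c ≤ meanDuration n (criticalK n)) :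
    1 ≤ upperIndex n c ∧ upperIndex n c ≤ n ∧ c ≤ meanDuration n (upperIndex n c) :=
  Nat.sSup_mem (s := {i : ℕ | 1 ≤ i ∧ i ≤ n ∧ c ≤ meanDuration n i})
    ⟨criticalK n, (criticalK_mem hn).1, criticalK_le hn, hc⟩ (bddAbove_indices c)

lemma meanDuration_lt_of_upperIndex_lt {c : ℝ} {i : ℕ} (h1 : 1 ≤ i) (hi : i ≤ n)
    (h : upperIndex n c < i) : meanDuration n i < c := by
  by_contra hc
  exact absurd (le_upperIndex h1 hi (not_lt.1 hc)) (not_le.2 h)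

lemma upperIndex_zero (hn : 1 ≤ n) : upperIndex n 0 = n := by
  have h := le_upperIndex (c := 0) hn le_rfl (by rw [meanDuration_top hn]; norm_num)
  exact le_antisymm (csSup_le ⟨n, hn, le_rfl, by rw [meanDuration_top hn]; norm_num⟩
    fun _ h => h.2.1) h

lemma sum_Icc_max_step (f : ℕ → ℝ) (i s b : ℕ) :
    ∑ j ∈ Icc (max (i + 1) s) b, f j =
      (if s ≤ i + 1 ∧ i + 1 ≤ b then f (i + 1) else 0) + ∑ j ∈ Icc (max (i + 1 + 1) s) b, f j := by
  split_ifs with h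
  · have : Icc (max (i + 1) s) b = insert (i + 1) (Icc (max (i + 1 + 1) s) b) := by
      ext j
      simp only [mem_Icc, mem_insert]
      omega
    rw [this, sum_insert (by simp only [mem_Icc]; omega)]
  · rw [zero_add]
    congr 1
    ext j
    simp only [mem_Icc]
    omega

/-- The increments do not involve `c`, and their sign changes at `criticalK n`: `gainOne` increases
before it and is nonincreasing from it on. -/
lemma gainOne_sub_succ {c : ℝ} {i : ℕ} (h1 : 1 ≤ i) (hi : i + 1 ≤ upperIndex n c) :
    gainOne n c i - gainOne n c (i + 1) = (1 - ((harmonic n : ℝ) - harmonic i)) / i := by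
  have : (i : ℝ) ≠ 0 := by positivity
  have h := sum_Icc_max_step
    (fun j => 1 / ((j : ℝ) - 1) * ((harmonic n : ℝ) - (harmonic (j - 1) : ℝ))) i 0 (upperIndex n c)
  simp only [Nat.zero_le, max_eq_left, true_and, hi, if_true] at h
  have hcast : ((i + 1 : ℕ) : ℝ) - 1 = i := by push_cast; ring
  rw [gainOne, gainOne, h, hcast, Nat.add_sub_cancel, harmonic_sub_one h1]
  field_simp
  ring

lemma mul_gainOne_upperIndex {c : ℝ} (h1 : 1 ≤ upperIndex n c) (hn : upperIndex n c ≤ n) :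
    (upperIndex n c : ℝ) * gainOne n c (upperIndex n c) = meanDuration n (upperIndex n c) - c := by
  have : (upperIndex n c : ℝ) ≠ 0 := by positivity
  rw [gainOne, Icc_eq_empty (by omega), sum_empty, meanDuration_eq h1 hn]
  field_simp
  ring

/-- The gain `G i` compares, up to the factor `i`, selecting at time `i` with the value of
continuing after `i` by selecting every candidate up to `b`. -/
lemma mul_gain_eq {c : ℝ} {s b : ℕ} {h G : ℕ → ℝ} (hn : upperIndex n c ≤ n)
    (hb : b ≤ upperIndex n c)
    (hG : ∀ i, 1 ≤ i → i ≤ upperIndex n c →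
      G i = gainOne n c i + ∑ j ∈ Icc (max (i + 1) s) b, 1 / ((j : ℝ) - 1) * h j)
    {i : ℕ} (h1 : 1 ≤ i) (hi : i ≤ upperIndex n c) :
    (i : ℝ) * G i = meanDuration n i - c + ∑ j ∈ Icc (max (i + 1) s) b, h j
      - ∑ j ∈ Icc (i + 1) (upperIndex n c), G j := by
  obtain ⟨e, he⟩ : ∃ e, upperIndex n c - i = e := ⟨_, rfl⟩
  induction e generalizing i with
  | zero =>
    obtain rfl : i = upperIndex n c := by omega
    rw [hG _ h1 le_rfl, Icc_eq_empty (a := upperIndex n c + 1) (by omega),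
      Icc_eq_empty (a := max _ _) (by omega)]
    simp only [sum_empty, add_zero, sub_zero]
    exact mul_gainOne_upperIndex h1 hn
  | succ e ih =>
    have hlt : i + 1 ≤ upperIndex n c := by omega
    have hi0 : (i : ℝ) ≠ 0 := by positivity
    have e1 := ih (i := i + 1) (by omega) hlt (by omega)
    have e2 := gainOne_sub_succ h1 hlt
    have e3 := meanDuration_sub_succ h1 (hlt.trans hn)
    have e4 := hG i h1 hi
    have e5 := hG (i + 1) (by omega) hlt
    have e6 := sum_Icc_max_step G i 0 (upperIndex n c)
    simp only [Nat.zero_le, max_eq_left, true_and, hlt, if_true] at e6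
    have e7 := sum_Icc_max_step h i s b
    have e8 := sum_Icc_max_step (fun j => 1 / ((j : ℝ) - 1) * h j) i s b
    rw [eq_div_iff hi0] at e2
    rw [e6, e7]
    -- The weight of the peeled term `j = i + 1` is `1 / i`, which the factor `i` cancels.
    have e9 : (i : ℝ) * ∑ j ∈ Icc (max (i + 1) s) b, 1 / ((j : ℝ) - 1) * h j =
        (if s ≤ i + 1 ∧ i + 1 ≤ b then h (i + 1) else 0) +
          i * ∑ j ∈ Icc (max (i + 1 + 1) s) b, 1 / ((j : ℝ) - 1) * h j := by
      rw [e8, mul_add]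
      congr 1
      split_ifs
      · have hcast : ((i + 1 : ℕ) : ℝ) - 1 = i := by push_cast; ring
        rw [hcast, ← mul_assoc, mul_one_div_cancel hi0, one_mul]
      · simp
    push_cast at e1
    have e10 := congrArg ((i : ℝ) * ·) e5
    have e11 := congrArg ((i : ℝ) * ·) e4
    simp only [mul_add] at e10 e11
    linear_combination e1 + e2 - e3 + e9 + e11 - e10

lemma sum_Icc_le_of_nonpos {F : ℕ → ℝ} {i lo hi : ℕ}
    (hF : ∀ j, i + 1 ≤ j → j < lo → j ≤ hi → F j ≤ 0) :
    ∑ j ∈ Icc (i + 1) hi, F j ≤ ∑ j ∈ Icc (max (i + 1) lo) hi, F j := by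
  have hsub : Icc (max (i + 1) lo) hi ⊆ Icc (i + 1) hi := Icc_subset_Icc_left (le_max_left _ _)
  rw [← sum_sdiff hsub]
  have : ∑ j ∈ Icc (i + 1) hi \ Icc (max (i + 1) lo) hi, F j ≤ 0 := by
    refine sum_nonpos fun j hj => ?_
    simp only [mem_sdiff, mem_Icc] at hj
    exact hF j hj.1.1 (by omega) hj.1.2
  linarith

/-- A function that is nonnegative on `[p, b]` and increasing before `p` crosses `0` once. -/
lemma single_crossing {φ : ℕ → ℝ} {p b : ℕ} (hp1 : 1 ≤ p) (hpb : p ≤ b)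
    (hpos : ∀ i, p ≤ i → i ≤ b → 0 ≤ φ i) (hmono : ∀ i, 1 ≤ i → i + 1 < p → φ i ≤ φ (i + 1)) :
    IsLeast {i : ℕ | 1 ≤ i ∧ i ≤ b ∧ 0 ≤ φ i} (sInf {i : ℕ | 1 ≤ i ∧ i ≤ b ∧ 0 ≤ φ i}) ∧
    sInf {i : ℕ | 1 ≤ i ∧ i ≤ b ∧ 0 ≤ φ i} ≤ p ∧
    ∀ i, sInf {i : ℕ | 1 ≤ i ∧ i ≤ b ∧ 0 ≤ φ i} ≤ i → i ≤ b → 0 ≤ φ i := by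
  have hmem : p ∈ {i : ℕ | 1 ≤ i ∧ i ≤ b ∧ 0 ≤ φ i} := ⟨hp1, hpb, hpos p le_rfl hpb⟩
  have hs := Nat.sInf_mem ⟨p, hmem⟩
  refine ⟨⟨hs, fun i hi => Nat.sInf_le hi⟩, Nat.sInf_le hmem, fun i hi hib => ?_⟩
  induction i, hi using Nat.le_induction with
  | base => exact hs.2.2
  | succ i hi ih =>
    by_cases h : i + 1 < p
    · exact (ih (by omega)).trans (hmono i (hs.1.trans hi) h)
    · exact hpos _ (by omega) hib

lemma gainOne_le_succ {c : ℝ} {i : ℕ} (h1 : 1 ≤ i) (hi : i + 1 ≤ upperIndex n c)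
    (hK : i < criticalK n) : gainOne n c i ≤ gainOne n c (i + 1) := by
  have e := gainOne_sub_succ h1 hi
  have := one_lt_of_lt_criticalK h1 hK
  have : (1 - ((harmonic n : ℝ) - harmonic i)) / i ≤ 0 :=
    div_nonpos_of_nonpos_of_nonneg (by linarith) (by positivity)
  linarith

/-- At the right end `b G_b = U_b - c ≥ 0`, and `gainOne` is nonincreasing on `[K, b]`. -/
lemma gainOne_nonneg {c : ℝ} (hn : 1 ≤ n) (hc : c ≤ meanDuration n (criticalK n)) {i : ℕ}
    (hK : criticalK n ≤ i) (hi : i ≤ upperIndex n c) : 0 ≤ gainOne n c i := by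
  obtain ⟨hb1, hbn, hbc⟩ := upperIndex_mem hn hc
  have h1 := (criticalK_mem hn).1
  obtain ⟨e, he⟩ : ∃ e, upperIndex n c - i = e := ⟨_, rfl⟩
  induction e generalizing i with
  | zero =>
    obtain rfl : i = upperIndex n c := by omega
    have h := mul_gainOne_upperIndex hb1 hbn
    have : (0 : ℝ) < upperIndex n c := by positivity
    exact nonneg_of_mul_nonneg_right (by rw [h]; linarith) this
  | succ e ih =>
    have hlt : i + 1 ≤ upperIndex n c := by omega
    have e1 := gainOne_sub_succ (h1.trans hK) hlt
    have := le_one_of_criticalK_le hn hK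
    have : 0 ≤ (1 - ((harmonic n : ℝ) - harmonic i)) / i :=
      div_nonneg (by linarith) (by positivity)
    have := ih (i := i + 1) (by omega) hlt (by omega)
    linarith

/-! ### Critical numbers and the value of replacements -/

/-- The value `0` at index `0` lets the recursion start from `k = 0`. -/
lemma gain_succ (c : ℝ) (s : ℕ → ℕ) (k i : ℕ) :
    gain n c s (k + 1) i = gainOne n c i +
      ∑ j ∈ Icc (max (i + 1) (s k)) (upperIndex n c), 1 / ((j : ℝ) - 1) * gain n c s k j := by
  cases k <;> simp [gain]

/-- The critical numbers together with the gain functions, by simultaneous recursion. -/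
noncomputable def criticalPair (n : ℕ) (c : ℝ) : ℕ → ℕ × (ℕ → ℝ)
  | 0 => (upperIndex n c + 1, 0)
  | k + 1 =>
    let G : ℕ → ℝ := fun i => gainOne n c i +
      ∑ j ∈ Icc (max (i + 1) (criticalPair n c k).1) (upperIndex n c),
        1 / ((j : ℝ) - 1) * (criticalPair n c k).2 j
    (sInf {i : ℕ | 1 ≤ i ∧ i ≤ upperIndex n c ∧ 0 ≤ G i}, G)

/-- The critical numbers `s_k(c)`; `s_0(c)` is conventionally `b(n, c) + 1`. -/
noncomputable def critical (n : ℕ) (c : ℝ) (k : ℕ) : ℕ := (criticalPair n c k).1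

lemma gain_critical (c : ℝ) (k : ℕ) : gain n c (critical n c) k = (criticalPair n c k).2 := by
  induction k with
  | zero => rfl
  | succ k ih =>
    funext i
    rw [gain_succ, ih]
    rfl

lemma critical_succ (c : ℝ) (k : ℕ) :
    critical n c (k + 1) =
      sInf {i : ℕ | 1 ≤ i ∧ i ≤ upperIndex n c ∧ 0 ≤ gain n c (critical n c) (k + 1) i} := by
  rw [gain_critical]
  rfl

/-- Below `s k` the continuation sum starts at `s k` for both indices, so only `gainOne` varies. -/
lemma gain_le_succ_of_lt (c : ℝ) (s : ℕ → ℕ) (k : ℕ) {i : ℕ} (h1 : 1 ≤ i)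
    (hb : i + 1 ≤ upperIndex n c) (hs : i + 1 < s k) (hK : i < criticalK n) :
    gain n c s (k + 1) i ≤ gain n c s (k + 1) (i + 1) := by
  rw [gain_succ, gain_succ, max_eq_right (by omega), max_eq_right (by omega)]
  have := gainOne_le_succ h1 hb hK
  linarith

/-- On `[s_k, b]` gains grow with `k`, and the range `[s_k, b]` grows too; so the next gain is
nonnegative on `[s_{k+1}, b]`. Since `s_{k+1} ≤ K`, it increases before that range, and
`single_crossing` applies with `p = s_{k+1}`. -/
lemma critical_spec {c : ℝ} (hn : 1 ≤ n) (hc : c ≤ meanDuration n (criticalK n)) (k : ℕ) :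
    IsLeast {i : ℕ | 1 ≤ i ∧ i ≤ upperIndex n c ∧ 0 ≤ gain n c (critical n c) (k + 1) i}
      (critical n c (k + 1)) ∧
    critical n c (k + 1) ≤ criticalK n ∧
    (∀ i, critical n c (k + 1) ≤ i → i ≤ upperIndex n c →
      0 ≤ gain n c (critical n c) (k + 1) i) ∧
    critical n c (k + 1) ≤ critical n c k ∧
    ∀ i, critical n c k ≤ i → i ≤ upperIndex n c →
      gain n c (critical n c) k i ≤ gain n c (critical n c) (k + 1) i := by
  have hKb := criticalK_le_upperIndex hn hc
  have hK1 := (criticalK_mem hn).1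
  -- With `s_0 = b + 1` the range `[s_0, b]` is empty, which makes the claims about `s_0` trivial.
  have h0 : critical n c 0 = upperIndex n c + 1 := rfl
  induction k with
  | zero =>
    obtain ⟨h1, h2, h3⟩ := single_crossing (φ := gain n c (critical n c) 1) hK1 hKb
      (fun i hi hib => gainOne_nonneg hn hc hi hib)
      (fun i hi hiK => gainOne_le_succ hi (by omega) (by omega))
    rw [← critical_succ] at h1 h2 h3
    exact ⟨h1, h2, h3, by omega, fun i hi hib => by omega⟩
  | succ k ih =>
    obtain ⟨i1, i2, i3, i4, i5⟩ := ih
    have hle : ∀ i, 1 ≤ i → gain n c (critical n c) (k + 1) i ≤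
        gain n c (critical n c) (k + 2) i := by
      intro i hi
      rw [gain_succ, gain_succ _ _ (k + 1)]
      refine add_le_add le_rfl ?_
      calc _ ≤ ∑ j ∈ Icc (max (i + 1) (critical n c k)) (upperIndex n c),
            1 / ((j : ℝ) - 1) * gain n c (critical n c) (k + 1) j := by
              refine sum_le_sum fun j hj => ?_
              rw [mem_Icc, max_le_iff] at hj
              have : (1 : ℝ) ≤ j := by exact_mod_cast (show 1 ≤ j by omega)
              exact mul_le_mul_of_nonneg_left (i5 j hj.1.2 hj.2)
                (div_nonneg zero_le_one (by linarith))
        _ ≤ _ := by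
              refine sum_le_sum_of_subset_of_nonneg
                (Icc_subset_Icc_left (max_le_max le_rfl i4)) fun j hj _ => ?_
              rw [mem_Icc, max_le_iff] at hj
              have : (1 : ℝ) ≤ j := by exact_mod_cast (show 1 ≤ j by omega)
              exact mul_nonneg (div_nonneg zero_le_one (by linarith)) (i3 j hj.1.2 hj.2)
    obtain ⟨h1, h2, h3⟩ := single_crossing (φ := gain n c (critical n c) (k + 2))
      i1.1.1 i1.1.2.1
      (fun i hi hib => (i3 i hi hib).trans (hle i (i1.1.1.trans hi)))
      (fun i hi his => gain_le_succ_of_lt c _ (k + 1) hi (by omega) his (by omega))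
    rw [← critical_succ] at h1 h2 h3
    exact ⟨h1, h2.trans i2, h3, h2, fun i hi hib => hle i (i1.1.1.trans hi)⟩

/-- The value, right after time `i`, of `k` available replacements. -/
noncomputable def replacementValue (n : ℕ) (c : ℝ) (k i : ℕ) : ℝ :=
  ∑ j ∈ Icc (max (i + 1) (critical n c k)) (upperIndex n c), gain n c (critical n c) k j

lemma replacementValue_zero (c : ℝ) (i : ℕ) : replacementValue n c 0 i = 0 :=
  sum_eq_zero fun _ _ => rfl

lemma replacementValue_of_upperIndex_le (c : ℝ) (k : ℕ) {i : ℕ} (h : upperIndex n c ≤ i) :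
    replacementValue n c k i = 0 := by
  rw [replacementValue, Icc_eq_empty (by omega), sum_empty]

lemma mul_gain_critical {c : ℝ} (hn : 1 ≤ n) (hc : c ≤ meanDuration n (criticalK n)) (k : ℕ)
    {i : ℕ} (h1 : 1 ≤ i) (hi : i ≤ upperIndex n c) :
    (i : ℝ) * gain n c (critical n c) (k + 1) i =
      meanDuration n i - c + replacementValue n c k i
        - ∑ j ∈ Icc (i + 1) (upperIndex n c), gain n c (critical n c) (k + 1) j :=
  mul_gain_eq (upperIndex_mem hn hc).2.1 le_rfl (s := critical n c k) (h := gain n c (critical n c) k)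
    (G := gain n c (critical n c) (k + 1)) (fun i _ _ => gain_succ c _ k i) h1 hi

/-- At `i = s_{k+1}` the continuation value `V_k(i)` is at most the sum of the later `G_j^{(k+1)}`,
so `i G_i^{(k+1)} ≥ 0` forces `U_i ≥ c`. -/
lemma lowerIndex_le_critical {c : ℝ} (hn : 1 ≤ n) (hc : c ≤ meanDuration n (criticalK n)) (k : ℕ) :
    lowerIndex n c ≤ critical n c (k + 1) := by
  obtain ⟨⟨⟨i1, i2, i3⟩, -⟩, -, i4, i5, i6⟩ := critical_spec hn hc k
  refine Nat.sInf_le ⟨i1, i2.trans (upperIndex_mem hn hc).2.1, ?_⟩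
  have e := mul_gain_critical hn hc k i1 i2
  have : replacementValue n c k (critical n c (k + 1)) ≤
      ∑ j ∈ Icc (critical n c (k + 1) + 1) (upperIndex n c),
        gain n c (critical n c) (k + 1) j := by
    refine (sum_le_sum (g := gain n c (critical n c) (k + 1)) fun j hj => ?_).trans
      (sum_le_sum_of_subset_of_nonneg (Icc_subset_Icc_left (le_max_left _ _)) fun j hj _ => ?_)
    · rw [mem_Icc, max_le_iff] at hj
      exact i6 j hj.1.2 hj.2
    · rw [mem_Icc] at hj
      exact i4 j (by omega) hj.2
  have := mul_nonneg (Nat.cast_nonneg (α := ℝ) (critical n c (k + 1))) i3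
  linarith

/-- Selecting a candidate at time `i` is right if `i` lies in `[s_k, b]`, and wrong otherwise. -/
lemma replacement_advantage {c : ℝ} (hn : 1 ≤ n) (hc : c ≤ meanDuration n (criticalK n)) (k : ℕ)
    {i : ℕ} (h1 : 1 ≤ i) (hi : i ≤ n) :
    (critical n c (k + 1) ≤ i → i ≤ upperIndex n c →
      meanDuration n i - c + replacementValue n c k i - replacementValue n c (k + 1) i =
        i * gain n c (critical n c) (k + 1) i) ∧
    (¬(critical n c (k + 1) ≤ i ∧ i ≤ upperIndex n c) →
      meanDuration n i - c + replacementValue n c k i ≤ replacementValue n c (k + 1) i) := by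
  obtain ⟨⟨⟨i1, i2, i3⟩, i7⟩, -, i4, i5, i6⟩ := critical_spec hn hc k
  have hneg : ∀ j, 1 ≤ j → j < critical n c (k + 1) → j ≤ upperIndex n c →
      gain n c (critical n c) (k + 1) j ≤ 0 := by
    intro j hj hjs hjb
    by_contra h
    exact absurd (i7 ⟨hj, hjb, (not_le.1 h).le⟩) (not_le.2 hjs)
  constructor
  · intro hs hb
    rw [mul_gain_critical hn hc k h1 hb, replacementValue, replacementValue,
      max_eq_left (a := i + 1) (b := critical n c (k + 1)) (by omega)]
  · intro h
    by_cases hb : i ≤ upperIndex n c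
    · have e := mul_gain_critical hn hc k h1 hb
      have e1 := sum_Icc_le_of_nonpos (F := gain n c (critical n c) (k + 1)) (i := i)
        (lo := critical n c (k + 1)) (hi := upperIndex n c)
        fun j hj1 hj2 hj3 => hneg j (by omega) hj2 hj3
      have e2 := mul_nonpos_of_nonneg_of_nonpos (Nat.cast_nonneg (α := ℝ) i)
        (hneg i h1 (by omega) hb)
      rw [replacementValue.eq_def n c (k + 1)]
      linarith
    -- Beyond `b` both continuation values vanish and `U_i < c`.
    · rw [replacementValue_of_upperIndex_le _ _ (by omega),
        replacementValue_of_upperIndex_le _ _ (by omega)]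
      have := meanDuration_lt_of_upperIndex_lt h1 hi (not_le.1 hb)
      linarith

/-! ### The first selection -/

/-- The constant difference `G_i^{(1)}(0) - G_i^{(1)}(c)`. -/
noncomputable def gainShift (n : ℕ) (c : ℝ) : ℝ :=
  gainOne n 0 (upperIndex n c) - gainOne n c (upperIndex n c)

lemma gainOne_zero_sub {c : ℝ} (hn : 1 ≤ n) (hb : upperIndex n c ≤ n) {i : ℕ} (h1 : 1 ≤ i)
    (hi : i ≤ upperIndex n c) : gainOne n 0 i - gainOne n c i = gainShift n c := by
  obtain ⟨e, he⟩ : ∃ e, upperIndex n c - i = e := ⟨_, rfl⟩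
  induction e generalizing i with
  | zero =>
    obtain rfl : i = upperIndex n c := by omega
    rfl
  | succ e ih =>
    have e1 := ih (i := i + 1) (by omega) (by omega) (by omega)
    have e2 := gainOne_sub_succ (n := n) (c := c) h1 (by omega)
    have e3 := gainOne_sub_succ (n := n) (c := 0) h1 (by rw [upperIndex_zero hn]; omega)
    linarith

/-- The gain for the first selection, on the whole range `1, …, n`. -/
noncomputable def firstGain (n : ℕ) (c : ℝ) (k i : ℕ) : ℝ :=
  gainOne n 0 i +
    ∑ j ∈ Icc (max (i + 1) (critical n c k)) (upperIndex n c),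
      1 / ((j : ℝ) - 1) * gain n c (critical n c) k j

lemma firstGain_eq {c : ℝ} (hn : 1 ≤ n) (hb : upperIndex n c ≤ n) (k : ℕ) {i : ℕ} (h1 : 1 ≤ i)
    (hi : i ≤ upperIndex n c) :
    firstGain n c k i = gain n c (critical n c) (k + 1) i + gainShift n c := by
  rw [firstGain, gain_succ, ← gainOne_zero_sub hn hb h1 hi]
  ring

lemma firstGain_of_lt {c : ℝ} (k : ℕ) {i : ℕ} (hi : upperIndex n c < i) :
    firstGain n c k i = gainOne n 0 i := by
  rw [firstGain, Icc_eq_empty (by omega), sum_empty, add_zero]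

/-- Since `b G_b^{(1)}(c) = U_b - c`, it is enough that `i G_i^{(1)}(0) ≥ U_i - c` at `i = b`; this
is proved downwards from `i = n`, where it reads `U_n ≥ U_n - c`. -/
lemma gainShift_nonneg {c : ℝ} (hn : 1 ≤ n) (hc0 : 0 ≤ c)
    (hc : c ≤ meanDuration n (criticalK n)) : 0 ≤ gainShift n c := by
  obtain ⟨hb1, hbn, hbc⟩ := upperIndex_mem hn hc
  have hz := upperIndex_zero hn
  have key : ∀ i, upperIndex n c ≤ i → i ≤ n → meanDuration n i - c ≤ i * gainOne n 0 i := by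
    intro i hbi hin
    obtain ⟨e, he⟩ : ∃ e, n - i = e := ⟨_, rfl⟩
    have h1 : 1 ≤ i := hb1.trans hbi
    induction e generalizing i with
    | zero =>
      obtain rfl : i = n := by omega
      have := mul_gainOne_upperIndex (n := i) (c := 0) (by omega) (by omega)
      rw [hz] at this
      linarith
    | succ e ih =>
      have e1 := ih (i + 1) (by omega) (by omega) (by omega) (by omega)
      have e2 := gainOne_sub_succ (n := n) (c := 0) h1 (by omega)
      have e3 := meanDuration_sub_succ (n := n) h1 (by omega)
      have e4 := meanDuration_lt_of_upperIndex_lt (n := n) (c := c) (i := i + 1) (by omega) (by omega)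
        (by omega)
      have hi0 : (0 : ℝ) < i := by positivity
      rw [eq_div_iff hi0.ne'] at e2
      push_cast at e1
      have e5 : (i + 1 : ℝ) * ((meanDuration n (i + 1) - c) / (i + 1)) ≤
          (i + 1 : ℝ) * gainOne n 0 (i + 1) := by
        rw [mul_div_cancel₀ _ (by positivity)]
        exact e1
      have e6 := le_of_mul_le_mul_left e5 (by positivity)
      have e7 := mul_le_mul_of_nonneg_left e6 hi0.le
      -- Beyond `b` the number `U_{i+1} - c` is negative, so the factor `i / (i + 1)` can only raise
      -- it.
      have e8 : meanDuration n (i + 1) - c ≤ i * ((meanDuration n (i + 1) - c) / (i + 1)) := by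
        rw [mul_div_assoc', le_div_iff₀ (by positivity)]
        nlinarith
      linarith
  have h1 := key _ le_rfl hbn
  have h2 := mul_gainOne_upperIndex hb1 hbn
  have h3 : (0 : ℝ) < upperIndex n c := by positivity
  rw [← h2] at h1
  have := le_of_mul_le_mul_left h1 h3
  rw [gainShift]
  linarith

/-! ### Stopping times -/

lemma IsStopping.lt_iff {σ : Equiv.Perm (Fin n) → ℕ} (hσ : IsStopping n σ) {i : ℕ}
    {ω ω' : Equiv.Perm (Fin n)} (h : ∀ j ≤ i - 1, relRank n ω j = relRank n ω' j) :
    σ ω < i ↔ σ ω' < i := by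
  constructor <;> intro hlt
  · rw [hσ (σ ω) ω ω' (fun j hj => h j (by omega)) rfl]
    exact hlt
  · rw [hσ (σ ω') ω' ω (fun j hj => (h j (by omega)).symm) rfl]
    exact hlt

lemma isStopping_const (c : ℕ) : IsStopping n fun _ => c := fun _ _ _ _ h => h

/-- The first candidate after `σ` in a fixed time interval. -/
lemma firstCandidate_after {σ τ : Equiv.Perm (Fin n) → ℕ} (hσ : IsStopping n σ)
    (hσn : ∀ ω, σ ω ≤ n + 1) {lo hi : ℕ} (hhi : hi ≤ n)
    (hτ : ∀ ω, τ ω = firstCandidate n ω (max (σ ω + 1) lo) hi) :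
    (IsStopping n τ ∧ ∀ ω, IsCandidate n ω (τ ω) ∨ τ ω = n + 1) ∧
      ∀ ω, σ ω < τ ω ∨ (σ ω = n + 1 ∧ τ ω = n + 1) := by
  have hmem := fun ω => firstCandidate_mem ω (max (σ ω + 1) lo) hi
  simp only [← hτ] at hmem
  have hcand : ∀ ω, IsCandidate n ω (τ ω) ∨ τ ω = n + 1 :=
    fun ω => (hmem ω).imp_left fun h => h.2.2
  have hlt : ∀ ω, σ ω < τ ω ∨ (σ ω = n + 1 ∧ τ ω = n + 1) := by
    intro ω
    have := hσn ω
    rcases hmem ω with h | h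
    · left; omega
    · omega
  refine ⟨⟨fun i ω ω' h hi => ?_, hcand⟩, hlt⟩
  have hc : ∀ j ≤ i, IsCandidate n ω j ↔ IsCandidate n ω' j := by
    intro j hj
    rw [IsCandidate, IsCandidate, h j hj]
  have hle : σ ω ≤ i := by rcases hlt ω with h' | h' <;> omega
  -- As `σ ≤ τ`, the first `i` ranks determine `σ`, so both orders search the same window.
  have hσe : σ ω' = σ ω := hσ _ ω ω' (fun j hj => h j (hj.trans hle)) rfl
  have h1 : τ ω' ≤ i := by
    rcases hmem ω with h' | h'
    · rw [hτ, hσe]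
      rw [hi] at h'
      exact firstCandidate_le h'.1 h'.2.1 ((hc i le_rfl).1 h'.2.2)
    · rcases hmem ω' with h'' | h'' <;> omega
  rcases hmem ω' with h' | h'
  · refine le_antisymm h1 ?_
    rw [← hi, hτ ω]
    rw [hσe] at h'
    exact firstCandidate_le h'.1 h'.2.1 ((hc _ h1).2 h'.2.2)
  · rcases hcand ω with h'' | h''
    · have := h''.bounds; omega
    · omega

lemma le_succ_of_candidate {ω : Equiv.Perm (Fin n)} {i : ℕ}
    (h : IsCandidate n ω i ∨ i = n + 1) : i ≤ n + 1 := by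
  rcases h with h | h
  · have := h.bounds; omega
  · exact h.le

lemma thresholdAfter_succ {m t b : ℕ} {s : ℕ → ℕ} {l k : ℕ} {τ : ℕ → Equiv.Perm (Fin n) → ℕ}
    (ω : Equiv.Perm (Fin n)) : thresholdAfter n m t b s l τ (k + 1) ω =
      if k + 1 ≤ l then τ (k + 1) ω
      else if k = 0 then firstCandidate n ω t n
      else firstCandidate n ω
        (max (thresholdAfter n m t b s l τ k ω + 1) (s (m - k))) b := rfl

lemma thresholdAfter_stoppingVector {m t b : ℕ} {s : ℕ → ℕ} {l : ℕ}
    {τ : ℕ → Equiv.Perm (Fin n) → ℕ} (ht : 1 ≤ t) (hb : b ≤ n)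
    (hτ : 1 ≤ l → StoppingVector n m τ) :
    StoppingVector n m (thresholdAfter n m t b s l τ) := by
  have H : ∀ k, k + 1 ≤ m → IsStopping n (thresholdAfter n m t b s l τ (k + 1)) ∧
      ∀ ω, IsCandidate n ω (thresholdAfter n m t b s l τ (k + 1) ω) ∨
        thresholdAfter n m t b s l τ (k + 1) ω = n + 1 := by
    intro k
    induction k with
    | zero =>
      intro hk
      by_cases hl : 1 ≤ l
      · have e : thresholdAfter n m t b s l τ (0 + 1) = τ (0 + 1) := by
          funext ω
          rw [thresholdAfter_succ, if_pos (by omega)]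
        rw [e]
        exact (hτ hl).1 (0 + 1) le_rfl hk
      · refine (firstCandidate_after (isStopping_const 0) (fun _ => by omega) (le_refl n)
          (lo := t) fun ω => ?_).1
        rw [thresholdAfter_succ, if_neg (by omega), if_pos rfl, max_eq_right (by omega)]
    | succ k ih =>
      intro hk
      by_cases hl : k + 1 + 1 ≤ l
      · have e : thresholdAfter n m t b s l τ (k + 1 + 1) = τ (k + 1 + 1) := by
          funext ω
          rw [thresholdAfter_succ, if_pos hl]
        rw [e]
        exact (hτ (by omega)).1 _ (by omega) hk
      · obtain ⟨i1, i2⟩ := ih (by omega)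
        refine (firstCandidate_after i1 (fun ω => le_succ_of_candidate (i2 ω)) hb
          (lo := s (m - (k + 1))) fun ω => ?_).1
        rw [thresholdAfter_succ, if_neg hl, if_neg (by omega)]
  refine ⟨fun k hk hkm => ?_, fun k hk hkm ω => ?_⟩
  · obtain ⟨j, rfl⟩ := Nat.exists_eq_add_of_le' hk
    exact H j hkm
  · obtain ⟨j, rfl⟩ := Nat.exists_eq_add_of_le' hk
    by_cases hl : j + 1 + 1 ≤ l
    · rw [thresholdAfter_succ, thresholdAfter_succ, if_pos hl, if_pos (by omega)]
      exact (hτ (by omega)).2 _ hk hkm ω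
    · obtain ⟨i1, i2⟩ := H j hkm.le
      refine (firstCandidate_after i1 (fun ω => le_succ_of_candidate (i2 ω)) hb
        (lo := s (m - (j + 1))) fun ω => ?_).2 ω
      rw [thresholdAfter_succ, if_neg hl, if_neg (by omega)]

/-! ### A single selection -/

lemma tail_sum_eq (F : ℕ → ℝ) {lo hi a b : ℕ} (h : a ≤ b) :
    ∑ i ∈ Icc (max (a + 1) lo) hi, F i =
      ∑ i ∈ Icc (max (b + 1) lo) hi, F i +
        ∑ i ∈ Icc (max 1 lo) hi, (if a < i ∧ i ≤ b then F i else 0) := by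
  have e : ∀ c, ∑ i ∈ Icc (max (c + 1) lo) hi, F i =
      ∑ i ∈ Icc (max 1 lo) hi, if c < i then F i else 0 := by
    intro c
    rw [← sum_filter]
    congr 1
    ext j
    simp only [mem_filter, mem_Icc]
    omega
  rw [e, e, ← sum_add_distrib]
  refine sum_congr rfl fun i _ => ?_
  by_cases h1 : a < i <;> by_cases h2 : b < i
  · simp [h1, h2]
  · simp [h1, not_lt.1 h2, h2]
  · omega
  · simp [h1, h2]

section OneSelection

variable {σ τ : Equiv.Perm (Fin n) → ℕ} {F f : ℕ → ℝ} {lo hi : ℕ}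

/-- The event `σ < i ≤ τ` is decided by the first `i - 1` ranks, so a sure `F i` has the same mean
as `i * F i` paid only when object `i` is a candidate. -/
lemma expectation_tail (hσ : IsStopping n σ) (hτ : IsStopping n τ)
    (hlt : ∀ ω, σ ω < τ ω ∨ (σ ω = n + 1 ∧ τ ω = n + 1)) (hhi : hi ≤ n) :
    expectation n (fun ω => ∑ i ∈ Icc (max (σ ω + 1) lo) hi, F i) =
      expectation n (fun ω => ∑ i ∈ Icc (max (τ ω + 1) lo) hi, F i +
        ∑ i ∈ Icc (max 1 lo) hi, if IsCandidate n ω i then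
          (if σ ω < i ∧ i ≤ τ ω then i * F i else 0) else 0) := by
  have e : ∀ ω, ∑ i ∈ Icc (max (σ ω + 1) lo) hi, F i =
      ∑ i ∈ Icc (max (τ ω + 1) lo) hi, F i +
        ∑ i ∈ Icc (max 1 lo) hi, (if σ ω < i ∧ i ≤ τ ω then F i else 0) :=
    fun ω => tail_sum_eq F (by rcases hlt ω with h | h <;> omega)
  simp only [e]
  rw [expectation_add, expectation_add, expectation_sum, expectation_sum]
  congr 1
  refine sum_congr rfl fun i hi' => ?_
  rw [mem_Icc, max_le_iff] at hi'
  have hdet : DeterminedBy (i - 1) fun ω => if σ ω < i ∧ i ≤ τ ω then F i else 0 := by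
    intro ω ω' h
    have h1 := hσ.lt_iff h
    have h2 := not_congr (hτ.lt_iff h)
    rw [not_lt, not_lt] at h2
    simp only [h1, h2]
  rw [expectation_candidate hi'.1.1 (hi'.2.trans hhi) hdet, ← expectation_mul_left]
  simp only [mul_ite, mul_zero]

/-- No selection after `σ` beats the tail sums of the gain function. -/
lemma expectation_selection_le (hσ : IsStopping n σ) (hτ : IsStopping n τ)
    (hcand : ∀ ω, IsCandidate n ω (τ ω) ∨ τ ω = n + 1)
    (hlt : ∀ ω, σ ω < τ ω ∨ (σ ω = n + 1 ∧ τ ω = n + 1)) (hhi : hi ≤ n)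
    (hpos : ∀ i, 1 ≤ i → lo ≤ i → i ≤ hi → 0 ≤ F i)
    (hin : ∀ i, 1 ≤ i → lo ≤ i → i ≤ hi →
      f i - ∑ j ∈ Icc (max (i + 1) lo) hi, F j = i * F i)
    (hout : ∀ i, 1 ≤ i → i ≤ n → ¬(lo ≤ i ∧ i ≤ hi) →
      f i ≤ ∑ j ∈ Icc (max (i + 1) lo) hi, F j) :
    expectation n (fun ω => if τ ω ≤ n then f (τ ω) else 0) ≤
      expectation n (fun ω => ∑ i ∈ Icc (max (σ ω + 1) lo) hi, F i) := by
  rw [expectation_tail hσ hτ hlt hhi]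
  refine expectation_mono fun ω => ?_
  have hterm : ∀ i ∈ Icc (max 1 lo) hi, (0 : ℝ) ≤ if IsCandidate n ω i then
      (if σ ω < i ∧ i ≤ τ ω then i * F i else 0) else 0 := by
    intro i hi'
    rw [mem_Icc, max_le_iff] at hi'
    have := hpos i hi'.1.1 hi'.1.2 hi'.2
    split_ifs <;> positivity
  have hsum := sum_nonneg hterm
  rcases hcand ω with hc | hc
  · have hbd := hc.bounds
    have hs : σ ω < τ ω := by rcases hlt ω with h | h <;> omega
    rw [if_pos hbd.2]
    by_cases hr : lo ≤ τ ω ∧ τ ω ≤ hi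
    · have h1 := single_le_sum hterm (mem_Icc.2 ⟨max_le hbd.1 hr.1, hr.2⟩)
      rw [if_pos hc, if_pos ⟨hs, le_rfl⟩] at h1
      have h2 := hin _ hbd.1 hr.1 hr.2
      linarith
    · have := hout _ hbd.1 hbd.2 hr
      linarith
  · rw [if_neg (by omega), Icc_eq_empty (a := max (τ ω + 1) lo) (by omega), sum_empty, zero_add]
    exact hsum

/-- Selecting the first candidate in `[lo, hi]` after `σ` attains the bound. -/
lemma expectation_selection_eq (hσ : IsStopping n σ) (hσn : ∀ ω, σ ω ≤ n + 1) (hhi : hi ≤ n)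
    (hτ : ∀ ω, τ ω = firstCandidate n ω (max (σ ω + 1) lo) hi)
    (hin : ∀ i, 1 ≤ i → lo ≤ i → i ≤ hi →
      f i - ∑ j ∈ Icc (max (i + 1) lo) hi, F j = i * F i) :
    expectation n (fun ω => if τ ω ≤ n then f (τ ω) else 0) =
      expectation n (fun ω => ∑ i ∈ Icc (max (σ ω + 1) lo) hi, F i) := by
  obtain ⟨⟨h1, -⟩, h3⟩ := firstCandidate_after hσ hσn hhi hτ
  rw [expectation_tail hσ h1 h3 hhi]
  congr 1
  funext ω
  -- No candidate of the window precedes `τ ω`, so nothing is lost in the bound.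
  have hzero : ∀ i ∈ Icc (max 1 lo) hi, i ≠ τ ω → (if IsCandidate n ω i then
      (if σ ω < i ∧ i ≤ τ ω then i * F i else 0) else 0) = 0 := by
    intro i hi' hne
    rw [mem_Icc, max_le_iff] at hi'
    split_ifs with hc hs
    · refine absurd (le_antisymm hs.2 ?_) hne
      rw [hτ]
      exact firstCandidate_le (max_le hs.1 hi'.1.2) hi'.2 hc
    · rfl
    · rfl
  have hmem := firstCandidate_mem ω (max (σ ω + 1) lo) hi
  rw [← hτ] at hmem
  rcases hmem with ⟨ha, hb, hc⟩ | hn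
  · have hbd := hc.bounds
    rw [max_le_iff] at ha
    rw [if_pos hbd.2, sum_eq_single (τ ω) hzero
      (fun h => absurd (mem_Icc.2 ⟨max_le hbd.1 ha.2, hb⟩) h), if_pos hc, if_pos ⟨ha.1, le_rfl⟩,
      ← hin _ hbd.1 ha.2 hb]
    ring
  · rw [if_neg (by omega), Icc_eq_empty (a := max (τ ω + 1) lo) (by omega), sum_empty,
      sum_eq_zero, zero_add]
    intro i hi'
    refine hzero i hi' ?_
    rw [mem_Icc] at hi'
    omega

end OneSelection

/-! ### Expected payoffs -/

/-- A selected candidate is worth its mean duration. -/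
lemma expectation_duration {τ : Equiv.Perm (Fin n) → ℕ} (hτ : IsStopping n τ)
    (hcand : ∀ ω, IsCandidate n ω (τ ω) ∨ τ ω = n + 1) :
    expectation n (fun ω => duration n ω (τ ω)) =
      expectation n (fun ω => if τ ω ≤ n then meanDuration n (τ ω) else 0) := by
  -- Decompose by the value of `τ`: the event `τ = i` is determined by the first `i` ranks.
  have e : ∀ g : ℕ → ℝ, ∀ ω, (if τ ω ≤ n then g (τ ω) else 0) =
      ∑ i ∈ Icc 1 n, (if τ ω = i then 1 else 0) * g i := by
    intro g ω
    simp only [ite_mul, one_mul, zero_mul, sum_ite_eq, mem_Icc]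
    rcases hcand ω with h | h
    · simp [h.bounds]
    · rw [if_neg (by omega), if_neg (by omega)]
  have e1 : ∀ ω, duration n ω (τ ω) = if τ ω ≤ n then duration n ω (τ ω) else 0 := by
    intro ω
    split_ifs with h
    · rfl
    · rcases hcand ω with hc | hc
      · exact absurd hc.bounds.2 h
      · rw [hc, duration_succ_top]
  have e2 : (fun ω => duration n ω (τ ω)) =
      fun ω => ∑ i ∈ Icc 1 n, (if τ ω = i then 1 else 0) * duration n ω i := by
    funext ω
    rw [e1, e (duration n ω)]
  rw [e2]
  simp only [e (meanDuration n)]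
  rw [expectation_sum, expectation_sum]
  refine sum_congr rfl fun i hi => ?_
  rw [mem_Icc] at hi
  have hdet : DeterminedBy i fun ω => if τ ω = i then (1 : ℝ) else 0 := by
    intro ω ω' h
    have : τ ω = i ↔ τ ω' = i := ⟨hτ i ω ω' h, hτ i ω' ω fun j hj => (h j hj).symm⟩
    simp only [this]
  simp only [mul_comm _ (meanDuration n i)]
  rw [expectation_mul_duration hi.1 hi.2 hdet, expectation_mul_left, meanDuration_eq hi.1 hi.2]

/-- The mean reward from the `k`-th selection, made at time `i`. -/
noncomputable def meanReward (n : ℕ) (d : ℝ) (k i : ℕ) : ℝ :=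
  if i ≤ n then meanDuration n i - (if k = 1 then 0 else d) else 0

lemma expectation_netPayoff {m : ℕ} (hm : 1 ≤ m) (d : ℝ) {τ : ℕ → Equiv.Perm (Fin n) → ℕ}
    (hτ : StoppingVector n m τ) :
    expectation n (netPayoff n m d τ) =
      ∑ k ∈ Icc 1 m, expectation n fun ω => meanReward n d k (τ k ω) := by
  have e : netPayoff n m d τ = fun ω => ∑ k ∈ Icc 1 m,
      (duration n ω (τ k ω) - if τ k ω ≤ n then (if k = 1 then 0 else d) else 0) := by
    funext ω
    rw [netPayoff, sum_sub_distrib]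
    congr 1
    have h := sum_Icc_max_step
      (fun k => if τ k ω ≤ n then (if k = 1 then 0 else d) else 0) 0 0 m
    simp only [Nat.zero_le, max_eq_left, true_and, zero_add, hm, if_true, ite_self] at h
    rw [h, card_filter]
    push_cast
    rw [mul_sum]
    refine sum_congr rfl fun k hk => ?_
    rw [mem_Icc] at hk
    rw [if_neg (show k ≠ 1 by omega)]
    split_ifs <;> simp
  rw [e, expectation_sum]
  refine sum_congr rfl fun k hk => ?_
  rw [mem_Icc] at hk
  obtain ⟨h1, h2⟩ := hτ.1 k hk.1 hk.2
  rw [expectation_sub, expectation_duration h1 h2, ← expectation_sub]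
  congr 1
  funext ω
  rw [meanReward]
  split_ifs <;> simp

/-- The mean reward of the first `l` selections together with the value of the remaining ones. -/
noncomputable def prefixValue (n m : ℕ) (d : ℝ) (τ : ℕ → Equiv.Perm (Fin n) → ℕ) (l : ℕ) : ℝ :=
  ∑ k ∈ Icc 1 l, expectation n (fun ω => meanReward n d k (τ k ω)) +
    expectation n fun ω => replacementValue n d (m - l) (τ l ω)

lemma prefixValue_last {m : ℕ} (hm : 1 ≤ m) (d : ℝ) {τ : ℕ → Equiv.Perm (Fin n) → ℕ}
    (hτ : StoppingVector n m τ) :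
    prefixValue n m d τ m = expectation n (netPayoff n m d τ) := by
  rw [expectation_netPayoff hm d hτ, prefixValue, Nat.sub_self]
  simp only [replacementValue_zero]
  rw [expectation_const, add_zero]

lemma expectation_reward_add {d : ℝ} (hb : upperIndex n d ≤ n) {τ : Equiv.Perm (Fin n) → ℕ}
    (j k : ℕ) :
    expectation n (fun ω => meanReward n d j (τ ω)) +
      expectation n (fun ω => replacementValue n d k (τ ω)) =
    expectation n (fun ω => if τ ω ≤ n then
      meanDuration n (τ ω) - (if j = 1 then 0 else d) + replacementValue n d k (τ ω) else 0) := by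
  rw [← expectation_add]
  congr 1
  funext ω
  rw [meanReward]
  by_cases h : τ ω ≤ n
  · rw [if_pos h, if_pos h]
  · rw [if_neg h, if_neg h, replacementValue_of_upperIndex_le _ _ (by omega), add_zero]

/-! ### Optimality of the threshold rules -/

section Optimality

variable {m : ℕ} {d : ℝ} {τ : ℕ → Equiv.Perm (Fin n) → ℕ}

lemma prefixValue_succ (hb : upperIndex n d ≤ n) {l : ℕ} (hl : 1 ≤ l) :
    prefixValue n m d τ (l + 1) =
      ∑ k ∈ Icc 1 l, expectation n (fun ω => meanReward n d k (τ k ω)) +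
      expectation n (fun ω => if τ (l + 1) ω ≤ n then meanDuration n (τ (l + 1) ω) - d +
        replacementValue n d (m - (l + 1)) (τ (l + 1) ω) else 0) := by
  rw [prefixValue, sum_Icc_succ_top (by omega), add_assoc, expectation_reward_add hb,
    if_neg (show l + 1 ≠ 1 by omega)]

/-- A supermartingale property: `expectation_selection_le` with `F = G^{(k+1)}` and reward `U - d +
V_k`, where `k + 1 = m - l`. -/
lemma prefixValue_succ_le (hn : 1 ≤ n) (hd : d ≤ meanDuration n (criticalK n))
    (hτ : StoppingVector n m τ) {l : ℕ} (hl : 1 ≤ l) (hlm : l < m) :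
    prefixValue n m d τ (l + 1) ≤ prefixValue n m d τ l := by
  have hb := (upperIndex_mem hn hd).2.1
  rw [prefixValue_succ hb hl, prefixValue]
  obtain ⟨k, hk⟩ : ∃ k, m - l = k + 1 := ⟨m - l - 1, by omega⟩
  rw [hk, show m - (l + 1) = k by omega]
  refine add_le_add le_rfl ?_
  obtain ⟨h1, -⟩ := hτ.1 l hl hlm.le
  obtain ⟨h2, h3⟩ := hτ.1 (l + 1) (by omega) hlm
  exact expectation_selection_le (f := fun i => meanDuration n i - d + replacementValue n d k i)
    h1 h2 h3 (hτ.2 l hl hlm) hb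
    (fun i _ hs hib => (critical_spec hn hd k).2.2.1 i hs hib)
    (fun i hi hs hib => (replacement_advantage hn hd k hi (hib.trans hb)).1 hs hib)
    (fun i hi hin h => (replacement_advantage hn hd k hi hin).2 h)

lemma prefixValue_succ_eq (hn : 1 ≤ n) (hd : d ≤ meanDuration n (criticalK n))
    (hτ : StoppingVector n m τ) {l : ℕ} (hl : 1 ≤ l) (hlm : l < m)
    (hthr : ∀ ω, τ (l + 1) ω =
      firstCandidate n ω (max (τ l ω + 1) (critical n d (m - l))) (upperIndex n d)) :
    prefixValue n m d τ (l + 1) = prefixValue n m d τ l := by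
  have hb := (upperIndex_mem hn hd).2.1
  rw [prefixValue_succ hb hl, prefixValue]
  obtain ⟨k, hk⟩ : ∃ k, m - l = k + 1 := ⟨m - l - 1, by omega⟩
  rw [hk] at hthr
  rw [hk, show m - (l + 1) = k by omega]
  congr 1
  obtain ⟨h1, h2⟩ := hτ.1 l hl hlm.le
  exact expectation_selection_eq (f := fun i => meanDuration n i - d + replacementValue n d k i)
    h1 (fun ω => le_succ_of_candidate (h2 ω)) hb hthr
    (fun i hi hs hib => (replacement_advantage hn hd k hi (hib.trans hb)).1 hs hib)

lemma netPayoff_le_prefixValue (hn : 1 ≤ n) (hd : d ≤ meanDuration n (criticalK n))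
    (hτ : StoppingVector n m τ) {l : ℕ} (hl : 1 ≤ l) (hlm : l ≤ m) :
    expectation n (netPayoff n m d τ) ≤ prefixValue n m d τ l := by
  rw [← prefixValue_last (hl.trans hlm) d hτ]
  exact Nat.decreasingInduction' (P := fun j => prefixValue n m d τ m ≤ prefixValue n m d τ j)
    (fun j hjm hlj ih => ih.trans (prefixValue_succ_le hn hd hτ (hl.trans hlj) hjm)) hlm le_rfl

lemma netPayoff_eq_prefixValue (hn : 1 ≤ n) (hd : d ≤ meanDuration n (criticalK n))
    (hτ : StoppingVector n m τ) {l : ℕ} (hl : 1 ≤ l) (hlm : l ≤ m)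
    (hthr : ∀ j, l ≤ j → j < m → ∀ ω, τ (j + 1) ω =
      firstCandidate n ω (max (τ j ω + 1) (critical n d (m - j))) (upperIndex n d)) :
    expectation n (netPayoff n m d τ) = prefixValue n m d τ l := by
  rw [← prefixValue_last (hl.trans hlm) d hτ]
  exact Nat.decreasingInduction' (P := fun j => prefixValue n m d τ m = prefixValue n m d τ j)
    (fun j hjm hlj ih => ih.trans
      (prefixValue_succ_eq hn hd hτ (hl.trans hlj) hjm (hthr j hlj hjm))) hlm rfl

/-- Following the threshold rule after `l ≥ 1` selections is optimal. -/
lemma expectation_le_thresholdAfter (hn : 1 ≤ n) (hd : d ≤ meanDuration n (criticalK n))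
    {t : ℕ} (ht : 1 ≤ t) (hτ : StoppingVector n m τ) {l : ℕ} (hl : 1 ≤ l) (hlm : l ≤ m) :
    expectation n (netPayoff n m d τ) ≤ expectation n
      (netPayoff n m d (thresholdAfter n m t (upperIndex n d) (critical n d) l τ)) := by
  have hb := (upperIndex_mem hn hd).2.1
  have hkeep : ∀ k, 1 ≤ k → k ≤ l →
      thresholdAfter n m t (upperIndex n d) (critical n d) l τ k = τ k := by
    intro k hk hkl
    obtain ⟨j, rfl⟩ := Nat.exists_eq_add_of_le' hk
    funext ω
    rw [thresholdAfter_succ, if_pos hkl]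
  rw [netPayoff_eq_prefixValue hn hd (thresholdAfter_stoppingVector ht hb fun _ => hτ) hl hlm
    fun j hlj hjm ω => by rw [thresholdAfter_succ, if_neg (by omega), if_neg (by omega)]]
  -- The prefix value depends only on the first `l` selections, which both strategies share.
  refine (netPayoff_le_prefixValue hn hd hτ hl hlm).trans_eq ?_
  rw [prefixValue, prefixValue, hkeep l hl le_rfl]
  congr 1
  refine sum_congr rfl fun k hk => ?_
  rw [mem_Icc] at hk
  rw [hkeep k hk.1 hk.2]

/-- The threshold rule with first threshold `t` is optimal from the start if the gain `firstGain`
of the first selection changes sign at `t`. -/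
lemma expectation_le_thresholdRule (hn : 1 ≤ n) (hm : 1 ≤ m)
    (hd : d ≤ meanDuration n (criticalK n)) {t : ℕ} (ht : 1 ≤ t)
    (hpos : ∀ i, t ≤ i → i ≤ n → 0 ≤ firstGain n d (m - 1) i)
    (hneg : ∀ i, 1 ≤ i → i < t → firstGain n d (m - 1) i ≤ 0) (hτ : StoppingVector n m τ) :
    expectation n (netPayoff n m d τ) ≤ expectation n
      (netPayoff n m d (thresholdRule n m t (upperIndex n d) (critical n d))) := by
  have hb := (upperIndex_mem hn hd).2.1
  have hz := upperIndex_zero hn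
  have hone : ∀ τ : ℕ → Equiv.Perm (Fin n) → ℕ, prefixValue n m d τ 1 =
      expectation n (fun ω => if τ 1 ω ≤ n then
        meanDuration n (τ 1 ω) - 0 + replacementValue n d (m - 1) (τ 1 ω) else 0) := by
    intro τ
    rw [prefixValue, Icc_self, sum_singleton, expectation_reward_add hb, if_pos rfl]
  have hid : ∀ i, 1 ≤ i → i ≤ n → (i : ℝ) * firstGain n d (m - 1) i =
      meanDuration n i - 0 + replacementValue n d (m - 1) i
        - ∑ j ∈ Icc (i + 1) n, firstGain n d (m - 1) j := by
    intro i h1 hi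
    -- Here the two upper bounds of `mul_gain_eq` differ: the base gain has `c = 0` and runs up to
    -- `n`, the continuation still stops at `b(n, d)`.
    have h := mul_gain_eq (n := n) (c := 0) (s := critical n d (m - 1)) (b := upperIndex n d)
      (h := gain n d (critical n d) (m - 1)) (G := firstGain n d (m - 1)) hz.le
      (by rw [hz]; exact hb) (fun i _ _ => rfl) h1 (by rw [hz]; exact hi)
    rw [hz] at h
    exact h
  have hin : ∀ i, 1 ≤ i → t ≤ i → i ≤ n →
      meanDuration n i - 0 + replacementValue n d (m - 1) i -
        ∑ j ∈ Icc (max (i + 1) t) n, firstGain n d (m - 1) j = i * firstGain n d (m - 1) i := by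
    intro i h1 hti hi
    rw [hid i h1 hi, max_eq_left (by omega)]
  have hout : ∀ i, 1 ≤ i → i ≤ n → ¬(t ≤ i ∧ i ≤ n) →
      meanDuration n i - 0 + replacementValue n d (m - 1) i ≤
        ∑ j ∈ Icc (max (i + 1) t) n, firstGain n d (m - 1) j := by
    intro i h1 hi hr
    have e1 := hid i h1 hi
    have e2 := sum_Icc_le_of_nonpos (F := firstGain n d (m - 1)) (i := i) (lo := t) (hi := n)
      fun j hj1 hj2 _ => hneg j (by omega) hj2
    have e3 := mul_nonpos_of_nonneg_of_nonpos (Nat.cast_nonneg (α := ℝ) i)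
      (hneg i h1 (by omega))
    linarith
  have hrule : StoppingVector n m (thresholdRule n m t (upperIndex n d) (critical n d)) :=
    thresholdAfter_stoppingVector ht hb fun h => absurd h (by omega)
  have hfirst : ∀ ω, thresholdRule n m t (upperIndex n d) (critical n d) 1 ω =
      firstCandidate n ω (max (0 + 1) t) n := by
    intro ω
    rw [thresholdRule, thresholdAfter_succ (k := 0), if_neg (by omega), if_pos rfl,
      max_eq_right (by omega)]
  rw [netPayoff_eq_prefixValue hn hd hrule le_rfl hm fun j hlj hjm ω => by
    rw [thresholdRule, thresholdAfter_succ, if_neg (by omega), if_neg (by omega)]]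
  refine (netPayoff_le_prefixValue hn hd hτ le_rfl hm).trans ?_
  obtain ⟨h1, h2⟩ := hτ.1 1 le_rfl hm
  -- The first selection counts as one made after the constant time `0`, at no cost.
  rw [hone, hone, expectation_selection_eq
    (f := fun i => meanDuration n i - 0 + replacementValue n d (m - 1) i)
    (isStopping_const 0) (fun _ => by omega) le_rfl hfirst hin]
  refine expectation_selection_le
    (f := fun i => meanDuration n i - 0 + replacementValue n d (m - 1) i)
    (isStopping_const 0) h1 h2 (fun ω => Or.inl ?_) le_rfl (fun i _ => hpos i) hin hout
  rcases h2 ω with h | h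
  · exact h.bounds.1
  · omega

end Optimality

end ReplacementDuration

/-! ### The main theorem -/

open ReplacementDuration in
theorem theorem5 (n m : ℕ) (d : ℝ) (hn : 1 ≤ n) (hm : 2 ≤ m) (hd : 0 < d)
    (hdK : d < meanDuration n (criticalK n)) :
    ∃ (s : ℕ → ℕ) (t : ℕ) (g : ℝ),
      -- `s_k = s_k(d)` is the least `i` with `G_i^{(k)}(d) ≥ 0`, for `1 ≤ k ≤ m`
      (∀ k, 1 ≤ k → k ≤ m →
        IsLeast {i : ℕ | 1 ≤ i ∧ i ≤ upperIndex n d ∧ 0 ≤ gain n d s k i} (s k)) ∧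
      -- the `s_k` are nonincreasing in `k` and at least `a(n, d)`
      (∀ k, 1 ≤ k → k < m → s (k + 1) ≤ s k) ∧
      lowerIndex n d ≤ s m ∧
      -- `g = g(d)` is the common value of `G_i^{(1)}(0) - G_i^{(1)}(d)`
      (∀ i, 1 ≤ i → i ≤ upperIndex n d → gainOne n 0 i - gainOne n d i = g) ∧
      -- `t = t_m(d)`
      IsLeast {i : ℕ | 1 ≤ i ∧ i ≤ upperIndex n d ∧ 0 ≤ gain n d s m i + g} t ∧
      t ≤ s m ∧
      -- the threshold rule is an optimal strategy
      StoppingVector n m (thresholdRule n m t (upperIndex n d) s) ∧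
      (∀ τ, StoppingVector n m τ →
        expectation n (netPayoff n m d τ) ≤
          expectation n (netPayoff n m d (thresholdRule n m t (upperIndex n d) s))) ∧
      -- it remains optimal to follow it after any `l` selections, however these were made
      (∀ l, 1 ≤ l → l ≤ m → ∀ τ, StoppingVector n m τ →
        StoppingVector n m (thresholdAfter n m t (upperIndex n d) s l τ) ∧
        expectation n (netPayoff n m d τ) ≤
          expectation n
            (netPayoff n m d (thresholdAfter n m t (upperIndex n d) s l τ))) := by
  have hdK' := hdK.le
  obtain ⟨-, hbn, -⟩ := upperIndex_mem hn hdK'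
  have hKb := criticalK_le_upperIndex hn hdK'
  obtain ⟨M, rfl⟩ : ∃ M, m = M + 1 := ⟨m - 1, by omega⟩
  have hg := gainShift_nonneg hn hd.le hdK'
  obtain ⟨hm1, hm2, hm3, hm4, -⟩ := critical_spec hn hdK' M
  obtain ⟨ht1, ht2, ht3⟩ := single_crossing
    (φ := fun i => gain n d (critical n d) (M + 1) i + gainShift n d) hm1.1.1 hm1.1.2.1
    (fun i h1 h2 => add_nonneg (hm3 i h1 h2) hg)
    (fun i h1 h2 => add_le_add
      (gain_le_succ_of_lt d _ M h1 (by omega) (by omega) (by omega)) le_rfl)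
  set t := sInf {i : ℕ | 1 ≤ i ∧ i ≤ upperIndex n d ∧
    0 ≤ gain n d (critical n d) (M + 1) i + gainShift n d}
  have hpos : ∀ i, t ≤ i → i ≤ n → 0 ≤ firstGain n d M i := by
    intro i h1 h2
    by_cases hib : i ≤ upperIndex n d
    · rw [firstGain_eq hn hbn M (ht1.1.1.trans h1) hib]
      exact ht3 i h1 hib
    · rw [firstGain_of_lt M (not_le.1 hib)]
      -- Beyond `b ≥ K` only `G^{(1)}(0)` remains, which is nonnegative on `[K, n]`.
      exact gainOne_nonneg hn (hd.le.trans hdK') (by omega) (by rw [upperIndex_zero hn]; exact h2)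
  have hneg : ∀ i, 1 ≤ i → i < t → firstGain n d M i ≤ 0 := by
    intro i h1 h2
    have hib : i ≤ upperIndex n d := h2.le.trans ht1.1.2.1
    rw [firstGain_eq hn hbn M h1 hib]
    by_contra h
    exact absurd (ht1.2 ⟨h1, hib, (not_le.1 h).le⟩) (not_le.2 h2)
  refine ⟨critical n d, t, gainShift n d, ?_, ?_, lowerIndex_le_critical hn hdK' M,
    fun i h1 h2 => gainOne_zero_sub hn hbn h1 h2, ht1, ht2,
    thresholdAfter_stoppingVector ht1.1.1 hbn fun h => absurd h (by omega),
    fun τ hτ => expectation_le_thresholdRule hn (by omega) hdK' ht1.1.1 hpos hneg hτ,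
    fun l h1 h2 τ hτ => ⟨thresholdAfter_stoppingVector ht1.1.1 hbn fun _ => hτ,
      expectation_le_thresholdAfter hn hdK' ht1.1.1 hτ h1 h2⟩⟩
  · intro k hk _
    obtain ⟨j, rfl⟩ := Nat.exists_eq_add_of_le' hk
    exact (critical_spec hn hdK' j).1
  · intro k hk _
    exact (critical_spec hn hdK' k).2.2.2.1
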